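/- For a triangulated category $\mathcal T$ let $\mathcal T^{\sim}$ be its idempotent completion, with the induced shift and with the direct summands of distinguished triangles of $\mathcal T$ as distinguished triangles. $K_0(\mathcal T^{\sim})$ is the abelian group generated by the objects of $\mathcal T^{\sim}$ with a relation $[Y]=[X]+[Z]$ for each distinguished triangle $X\to Y\to Z\to X[1]$. (i) Let $\mathcal T$ be an essentially small triangulated category. If $K_0(\mathcal T^{\sim})=0$, then $\mathcal T$ is idempotent complete. (ii) Let $\mathbf E=(\mathcal E,w)$ be an essentially small idempotent complete exact category $\mathcal E$ with a class $w$ of weak equivalences, i.e. a class of morphisms that contains all isomorphisms, satisfies the two-out-of-three property, is closed under retracts, and is closed under extensions: for every morphism of conflations with outer components in $w$, the middle component is in $w$. (This includes every complicial exact category with weak equivalences whose underlying exact category is essentially small and idempotent complete, and the case where $w$ is the class of isomorphisms.) Let $\mathcal E^w$ be the full subcategory of objects $x$ with $0\to x$ in $w$. Let $\mathcal D(\mathcal E)$ be the unbounded derived category of $\mathcal E$, i.e. the Verdier quotient of the homotopy category of unbounded cochain complexes in $\mathcal E$ by the acyclic complexes. Call a complex $w$-acyclic if it becomes zero in the Verdier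 quotient of $\mathcal D(\mathcal E)$ by the thick subcategory generated by the bounded complexes of objects of $\mathcal E^w$, and let $\mathcal D(\mathbf E)$ be the Verdier quotient of the homotopy category of unbounded complexes in $\mathcal E$ by the $w$-acyclic complexes. Then $\mathcal D(\mathbf E)$ is idempotent complete if and only if $K_0(\mathcal D(\mathbf E)^{\sim})=0$. -/

import Mathlib

open CategoryTheory CategoryTheory.Limits CategoryTheory.Pretriangulated

universe w₁ w₂ v₁ v₂ u₁ u₂

noncomputable section

namespace HigherDerived

/-! ### The idempotent completion of a triangulated category and its Grothendieck group -/

section IdempotentCompletion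

variable (T : Type u₁) [Category.{v₁} T] [Preadditive T] [HasShift T ℤ]

/-- The shift on the idempotent completion `Karoubi T`, given on objects by
`(X, p)⟦n⟧ = (X⟦n⟧, p⟦n⟧)` and on morphisms by `f ↦ f⟦n⟧`. -/
instance karoubiHasShift : HasShift (Idempotents.Karoubi T) ℤ :=
  HasShift.induced (Idempotents.toKaroubi T) ℤ
    (fun n => (Idempotents.functorExtension₂ T T).obj (shiftFunctor T n))
    (fun n => (Idempotents.functorExtension₂CompWhiskeringLeftToKaroubiIso T T).app
      (shiftFunctor T n))

/-- The embedding of `T` in its idempotent completion commutes with the shift. -/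
instance toKaroubiCommShift : (Idempotents.toKaroubi T).CommShift ℤ :=
  Functor.CommShift.ofInduced (Idempotents.toKaroubi T) ℤ
    (fun n => (Idempotents.functorExtension₂ T T).obj (shiftFunctor T n))
    (fun n => (Idempotents.functorExtension₂CompWhiskeringLeftToKaroubiIso T T).app
      (shiftFunctor T n))

variable [HasZeroObject T] [∀ n : ℤ, (shiftFunctor T n).Additive] [Pretriangulated T]

/-- The distinguished triangles of the idempotent completion of a triangulated category:
the triangles which are direct summands (that is, retracts) of the
image of a distinguished triangle of `T`. -/
def karoubiDistTriang : Set (Triangle (Idempotents.Karoubi T)) :=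
  {S | ∃ R : Triangle T, R ∈ distTriang T ∧
    Nonempty (Retract S ((Idempotents.toKaroubi T).mapTriangle.obj R))}

end IdempotentCompletion

/-- The relations `[Y] - [X] - [Z]`, one for each distinguished triangle `X ⟶ Y ⟶ Z ⟶ X⟦1⟧`. -/
def k0Relations (C : Type u₁) [Category.{v₁} C] [HasShift C ℤ] (dist : Set (Triangle C)) :
    AddSubgroup (FreeAbelianGroup C) :=
  AddSubgroup.closure {r | ∃ S ∈ dist, r =
    FreeAbelianGroup.of S.obj₂ - FreeAbelianGroup.of S.obj₁ - FreeAbelianGroup.of S.obj₃}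

/-- The Grothendieck group of a category with shift and a class of distinguished triangles: the
abelian group generated by the objects, with `[Y] = [X] + [Z]` for each distinguished
triangle `X ⟶ Y ⟶ Z ⟶ X⟦1⟧`. -/
abbrev K0 (C : Type u₁) [Category.{v₁} C] [HasShift C ℤ] (dist : Set (Triangle C)) : Type u₁ :=
  FreeAbelianGroup C ⧸ k0Relations C dist

/-- The Grothendieck group of the idempotent completion of a triangulated category. -/
abbrev K0Completion (T : Type u₁) [Category.{v₁} T] [Preadditive T] [HasZeroObject T]
    [HasShift T ℤ] [∀ n : ℤ, (shiftFunctor T n).Additive] [Pretriangulated T] :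
    Type (max u₁ v₁) :=
  K0 (Idempotents.Karoubi T) (karoubiDistTriang T)

/-! ### Verdier quotients -/

section Verdier

open scoped ZeroObject

variable {T : Type u₁} [Category.{v₁} T] [Preadditive T] [HasZeroObject T] [HasShift T ℤ]
  [∀ n : ℤ, (shiftFunctor T n).Additive] [Pretriangulated T] [IsTriangulated T]

/-- The thick triangulated subcategory generated by a class of objects `P`: the smallest full
triangulated subcategory closed under direct summands and containing `P`. The zero
objects are added so that the empty class generates the zero subcategory. -/
def thickClosure (P : ObjectProperty T) : ObjectProperty T :=
  ObjectProperty.triangEnvelope (fun A => P A ∨ IsZero A)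

instance thickClosure_isTriangulated (P : ObjectProperty T) :
    (thickClosure P).IsTriangulated := by
  have : ObjectProperty.Nonempty (fun A : T => P A ∨ IsZero A) :=
    ⟨⟨0, Or.inr (isZero_zero T)⟩⟩
  unfold thickClosure
  infer_instance

/-- The Verdier quotient of a triangulated category by the thick subcategory generated by a
class of objects `P`: the localization at the morphisms whose cone lies in that subcategory. -/
abbrev Verdier (P : ObjectProperty T) : Type u₁ := (thickClosure P).trW.Localization

/-- The quotient functor. -/
abbrev verdierQ (P : ObjectProperty T) : T ⥤ Verdier P := (thickClosure P).trW.Q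

end Verdier

/-! ### Exact categories -/

section Exact

open scoped ZeroObject

variable (E : Type u₂) [Category.{v₂} E] [Preadditive E] [HasZeroObject E]
  [HasBinaryBiproducts E]

/-- `i` is the first map of a sequence of the class `conf`. -/
def IsInflation {E : Type u₂} [Category.{v₂} E] [Preadditive E]
    (conf : ObjectProperty (ShortComplex E)) {X Y : E} (i : X ⟶ Y) : Prop :=
  ∃ (Z : E) (p : Y ⟶ Z) (h : i ≫ p = 0), conf (ShortComplex.mk i p h)

/-- `p` is the second map of a sequence of the class `conf`. -/
def IsDeflation {E : Type u₂} [Category.{v₂} E] [Preadditive E]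
    (conf : ObjectProperty (ShortComplex E)) {Y Z : E} (p : Y ⟶ Z) : Prop :=
  ∃ (X : E) (i : X ⟶ Y) (h : i ≫ p = 0), conf (ShortComplex.mk i p h)

/-- A (Quillen) exact structure on an additive category. -/
structure ExactStructure where
  /-- the class of conflations `X ↣ Y ↠ Z` -/
  conflation : ObjectProperty (ShortComplex E)
  of_iso : ∀ {S S' : ShortComplex E}, (S ≅ S') → conflation S → conflation S'
  isKernel : ∀ S : ShortComplex E, conflation S → Nonempty (IsLimit (KernelFork.ofι S.f S.zero))
  isCokernel : ∀ S : ShortComplex E, conflation S →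
    Nonempty (IsColimit (CokernelCofork.ofπ S.g S.zero))
  inflation_id : ∀ X : E, IsInflation conflation (𝟙 X)
  deflation_id : ∀ X : E, IsDeflation conflation (𝟙 X)
  inflation_comp : ∀ {X Y Z : E} (i : X ⟶ Y) (j : Y ⟶ Z), IsInflation conflation i →
    IsInflation conflation j → IsInflation conflation (i ≫ j)
  deflation_comp : ∀ {X Y Z : E} (p : X ⟶ Y) (q : Y ⟶ Z), IsDeflation conflation p →
    IsDeflation conflation q → IsDeflation conflation (p ≫ q)
  inflation_pushout : ∀ {X Y X' : E} (i : X ⟶ Y) (f : X ⟶ X'), IsInflation conflation i →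
    ∃ (Y' : E) (g : Y ⟶ Y') (i' : X' ⟶ Y'), IsPushout i f g i' ∧ IsInflation conflation i'
  deflation_pullback : ∀ {Y Z Z' : E} (p : Y ⟶ Z) (f : Z' ⟶ Z), IsDeflation conflation p →
    ∃ (Y' : E) (g : Y' ⟶ Y) (p' : Y' ⟶ Z'), IsPullback g p' p f ∧ IsDeflation conflation p'

variable {E}

/-- A class of weak equivalences in an exact category: it contains the isomorphisms, has the
two out of three property, and is closed under extensions and under retracts. -/
structure IsWeakEquivalenceClass (X : ExactStructure E) (w : MorphismProperty E) : Prop where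
  of_isIso : MorphismProperty.isomorphisms E ≤ w
  two_out_of_three : w.HasTwoOutOfThreeProperty
  extension : ∀ {S S' : ShortComplex E} (φ : S ⟶ S'), X.conflation S → X.conflation S' →
    w φ.τ₁ → w φ.τ₃ → w φ.τ₂
  retract : w.IsStableUnderRetracts

/-- The `w`-trivial objects: those `A` for which `0 ⟶ A` is in `w`. -/
def wTrivial (w : MorphismProperty E) : ObjectProperty E :=
  fun A => w (0 : (0 : E) ⟶ A)

/-! ### The derived category of an exact category -/

variable (E) in
/-- The homotopy category of unbounded cochain complexes. -/
abbrev KCat : Type (max u₂ v₂) := HomotopyCategory E (ComplexShape.up ℤ)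

/-- A complex `A` is acyclic if each differential factors as a deflation `A n ↠ Z (n+1)` followed
by an inflation `Z (n+1) ↣ A (n+1)`, in such a way that all `Z n ↣ A n ↠ Z (n+1)` are
conflations. -/
def IsAcyclic (X : ExactStructure E) (A : CochainComplex E ℤ) : Prop :=
  ∃ (Z : ℤ → E) (i : ∀ n, Z n ⟶ A.X n) (p : ∀ n, A.X n ⟶ Z (n + 1)) (h : ∀ n, i n ≫ p n = 0),
    (∀ n, X.conflation (ShortComplex.mk (i n) (p n) (h n))) ∧
      ∀ n, p n ≫ i (n + 1) = A.d n (n + 1)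

/-- The acyclic complexes, as objects of the homotopy category. -/
def acyclicK (X : ExactStructure E) : ObjectProperty (KCat E) :=
  fun K => ∃ A : CochainComplex E ℤ, IsAcyclic X A ∧
    Nonempty (K ≅ (HomotopyCategory.quotient E (ComplexShape.up ℤ)).obj A)

/-- The derived category of an exact category: the homotopy category of unbounded complexes modulo
the acyclic complexes. -/
abbrev DExact (X : ExactStructure E) : Type (max u₂ v₂) := Verdier (acyclicK X)

/-- The functor sending a complex to the corresponding object of the derived category. -/
abbrev complexToDExact (X : ExactStructure E) : CochainComplex E ℤ ⥤ DExact X :=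
  HomotopyCategory.quotient E (ComplexShape.up ℤ) ⋙ verdierQ (acyclicK X)

/-- The bounded complexes of `w`-trivial objects. -/
def IsBoundedTrivial (w : MorphismProperty E) (A : CochainComplex E ℤ) : Prop :=
  (∃ a b : ℤ, ∀ n : ℤ, n < a ∨ b < n → IsZero (A.X n)) ∧ ∀ n : ℤ, wTrivial w (A.X n)

/-- The bounded complexes of `w`-trivial objects, as objects of the derived category. -/
def boundedTrivialD (X : ExactStructure E) (w : MorphismProperty E) :
    ObjectProperty (DExact X) :=
  fun K => ∃ A : CochainComplex E ℤ, IsBoundedTrivial w A ∧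
    Nonempty (K ≅ (complexToDExact X).obj A)

/-- The `w`-acyclic complexes: the complexes which become zero in the Verdier quotient of the
derived category of the exact category by the bounded complexes of `w`-trivial objects. This is
the closure of the latter complexes under quasi-isomorphisms. -/
def IsWAcyclic (X : ExactStructure E) (w : MorphismProperty E) (A : CochainComplex E ℤ) : Prop :=
  IsZero ((complexToDExact X ⋙ verdierQ (boundedTrivialD X w)).obj A)

/-- The `w`-acyclic complexes, as objects of the homotopy category. -/
def wAcyclicK (X : ExactStructure E) (w : MorphismProperty E) : ObjectProperty (KCat E) :=
  fun K => ∃ A : CochainComplex E ℤ, IsWAcyclic X w A ∧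
    Nonempty (K ≅ (HomotopyCategory.quotient E (ComplexShape.up ℤ)).obj A)

/-- The derived category of an exact category with weak equivalences: the homotopy category of
unbounded complexes, localized at the quasi-weak equivalences, that is, at the morphisms
whose cone is `w`-acyclic. -/
abbrev DCat (X : ExactStructure E) (w : MorphismProperty E) : Type (max u₂ v₂) :=
  Verdier (wAcyclicK X w)

end Exact
end HigherDerived
end

/-!
Call two objects of the idempotent completion `T^∼` equivalent if adding a common object moves both
of them into `T`. Every object of `T^∼` has a complement in `T`, so that the equivalence classes
form a group under direct sum. A distinguished triangle of `T^∼` whose outer objects lie in `T` has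
its middle object in `T`, and every distinguished triangle is of this kind after adding split
triangles; hence the class of an object is an additive invariant, and it vanishes exactly for the
objects of `T`. So the group is a quotient of `K₀(T^∼)` and `T` is idempotent complete as soon as
`K₀(T^∼) = 0`.

For the converse in part (ii), every unbounded complex is an extension of a bounded above complex by
a bounded below complex. Such a complex `A` has a direct sum `B` of shifts by even degrees with
`B ≅ A ⊞ B⟦e⟧`, and `[B⟦e⟧] = [B]` gives `[A] = 0`. Hence `K₀` of the homotopy category vanishes,
and with it `K₀` of each of its quotients.
-/

noncomputable section

namespace HigherDerived

open Idempotents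
open scoped ZeroObject

section K0

variable {C : Type u₁} [Category.{v₁} C] [HasShift C ℤ] (dist : Set (Triangle C))

/-- The class of an object in the Grothendieck group. -/
def k0Class (A : C) : K0 C dist := QuotientAddGroup.mk (FreeAbelianGroup.of A)

variable {dist}

lemma k0Class_obj₂ {S : Triangle C} (hS : S ∈ dist) :
    k0Class dist S.obj₂ = k0Class dist S.obj₁ + k0Class dist S.obj₃ := by
  have hrel : FreeAbelianGroup.of S.obj₂ - FreeAbelianGroup.of S.obj₁ -
      FreeAbelianGroup.of S.obj₃ ∈ k0Relations C dist :=
    AddSubgroup.subset_closure ⟨S, hS, rfl⟩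
  have hzero := (QuotientAddGroup.eq_zero_iff _).2 hrel
  rwa [QuotientAddGroup.mk_sub, QuotientAddGroup.mk_sub, sub_sub, sub_eq_zero] at hzero

/-- The universal property of the Grothendieck group: a function on objects which is additive on
the distinguished triangles extends to a homomorphism. -/
def k0Lift {G : Type*} [AddCommGroup G] (φ : C → G)
    (hφ : ∀ S ∈ dist, φ S.obj₂ = φ S.obj₁ + φ S.obj₃) : K0 C dist →+ G :=
  QuotientAddGroup.lift _ (FreeAbelianGroup.lift φ) <| (AddSubgroup.closure_le _).2 <| by
    rintro _ ⟨S, hS, rfl⟩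
    simp [hφ S hS]

lemma k0Lift_k0Class {G : Type*} [AddCommGroup G] (φ : C → G)
    (hφ : ∀ S ∈ dist, φ S.obj₂ = φ S.obj₁ + φ S.obj₃) (A : C) :
    k0Lift φ hφ (k0Class dist A) = φ A :=
  FreeAbelianGroup.lift_apply_of φ A

lemma subsingleton_k0_of_k0Class_eq_zero (h : ∀ A : C, k0Class dist A = 0) :
    Subsingleton (K0 C dist) := by
  have hmk : QuotientAddGroup.mk' (k0Relations C dist) = 0 := FreeAbelianGroup.lift_ext _ _ h
  refine subsingleton_of_forall_eq 0 fun a => ?_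
  obtain ⟨x, rfl⟩ := QuotientAddGroup.mk'_surjective _ a
  rw [hmk, AddMonoidHom.zero_apply]

lemma k0Class_zero [HasZeroObject C] [HasZeroMorphisms C]
    (hcontr : contractibleTriangle (0 : C) ∈ dist) : k0Class dist (0 : C) = 0 :=
  left_eq_add.1 (k0Class_obj₂ hcontr)

lemma k0Class_of_iso [HasZeroObject C] [HasZeroMorphisms C]
    (hcontr : ∀ A : C, contractibleTriangle A ∈ dist)
    (hiso : ∀ S ∈ dist, ∀ S', (S' ≅ S) → S' ∈ dist) {A B : C} (e : A ≅ B) :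
    k0Class dist A = k0Class dist B := by
  let S : Triangle C := Triangle.mk e.hom (0 : B ⟶ 0) 0
  have hS : S ∈ dist := hiso _ (hcontr A) _ <|
    Triangle.isoMk _ _ (Iso.refl _) e.symm (Iso.refl _)
      (e.hom_inv_id.trans (Category.comp_id _).symm) ((isZero_zero C).eq_of_tgt _ _)
      ((isZero_zero C).eq_of_src _ _)
  have hadd : k0Class dist B = k0Class dist A + k0Class dist (0 : C) := k0Class_obj₂ hS
  rw [hadd, k0Class_zero (hcontr 0), add_zero]

lemma subsingleton_k0_of_essSurj {D : Type u₂} [Category.{v₂} D] [HasShift D ℤ]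
    {dist' : Set (Triangle D)} (hiso : ∀ {A B : D}, (A ≅ B) → k0Class dist' A = k0Class dist' B)
    (F : C ⥤ D) [F.CommShift ℤ] [F.EssSurj]
    (hF : ∀ S ∈ dist, F.mapTriangle.obj S ∈ dist') [Subsingleton (K0 C dist)] :
    Subsingleton (K0 D dist') := by
  refine subsingleton_k0_of_k0Class_eq_zero fun Y => ?_
  have hmap : k0Class dist' (F.obj (F.objPreimage Y)) = 0 := by
    rw [← k0Lift_k0Class (fun X => k0Class dist' (F.obj X)) (fun S hS => k0Class_obj₂ (hF S hS)),
      Subsingleton.elim (k0Class dist _) 0, map_zero]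
  rw [← hiso (F.objObjPreimageIso Y), hmap]

end K0

section Pretriangulated

variable {T : Type u₁} [Category.{v₁} T] [Preadditive T] [HasZeroObject T]
  [HasShift T ℤ] [∀ n : ℤ, (shiftFunctor T n).Additive] [Pretriangulated T]

lemma k0Class_eq_of_iso {A B : T} (e : A ≅ B) :
    k0Class (distTriang T) A = k0Class (distTriang T) B :=
  k0Class_of_iso contractible_distinguished
    (fun S hS S' e' => isomorphic_distinguished S hS S' e') e

lemma k0Class_biprod (A B : T) :
    k0Class (distTriang T) (A ⊞ B) = k0Class (distTriang T) A + k0Class (distTriang T) B :=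
  k0Class_obj₂ (binaryBiproductTriangle_distinguished A B)

lemma k0Class_shift_one (A : T) :
    k0Class (distTriang T) (A⟦(1 : ℤ)⟧) = -k0Class (distTriang T) A := by
  have hadd : k0Class (distTriang T) (0 : T) = k0Class _ A + k0Class _ (A⟦(1 : ℤ)⟧) :=
    k0Class_obj₂ (contractible_distinguished₂ A)
  rw [k0Class_zero (contractible_distinguished 0)] at hadd
  exact (neg_eq_of_add_eq_zero_right hadd.symm).symm

lemma k0Class_shift (A : T) (n : ℤ) :
    k0Class (distTriang T) (A⟦n⟧) = n.negOnePow • k0Class (distTriang T) A := by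
  have hsucc (m : ℤ) : k0Class (distTriang T) (A⟦m + 1⟧) = -k0Class (distTriang T) (A⟦m⟧) := by
    rw [k0Class_eq_of_iso ((shiftFunctorAdd T m 1).app A)]
    exact k0Class_shift_one _
  induction n using Int.induction_on with
  | zero => rw [k0Class_eq_of_iso ((shiftFunctorZero T ℤ).app A)]; simp
  | succ m ih => rw [hsucc, ih, Int.negOnePow_succ, Units.neg_smul]
  | pred m ih =>
    rw [← neg_inj, ← hsucc, ← Units.neg_smul, ← Int.negOnePow_succ, sub_add_cancel, ih]

end Pretriangulated

section CofinalQuotient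

variable {C : Type u₁} [Category.{v₁} C] [HasZeroMorphisms C] [HasBinaryBiproducts C]

/-- A property of objects of an additive category is cofinal if it is closed under isomorphisms
and direct sums, and every object has a complement such that the direct sum has the property. -/
class IsCofinal (P : ObjectProperty C) : Prop extends P.IsClosedUnderIsomorphisms where
  biprod : ∀ {A B : C}, P A → P B → P (A ⊞ B)
  exists_biprod : ∀ A : C, ∃ D : C, P (A ⊞ D)

/-- Two objects are equivalent modulo `P` if a common complement makes both have the property
`P`. -/
def EquivModulo (P : ObjectProperty C) (A B : C) : Prop := ∃ D : C, P (A ⊞ D) ∧ P (B ⊞ D)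

/-- The exchange of the two inner summands of a direct sum of four objects. -/
def biprodInterchange (A B D D' : C) : (A ⊞ B) ⊞ (D ⊞ D') ≅ (A ⊞ D) ⊞ (B ⊞ D') where
  hom := biprod.lift (biprod.map biprod.fst biprod.fst) (biprod.map biprod.snd biprod.snd)
  inv := biprod.lift (biprod.map biprod.fst biprod.fst) (biprod.map biprod.snd biprod.snd)

variable {P : ObjectProperty C} {A B A' B' D : C}

lemma EquivModulo.symm (h : EquivModulo P A B) : EquivModulo P B A :=
  let ⟨D, hA, hB⟩ := h
  ⟨D, hB, hA⟩

lemma prop_biprod_comm [P.IsClosedUnderIsomorphisms] (h : P (A ⊞ B)) : P (B ⊞ A) :=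
  P.prop_of_iso (biprod.braiding A B) h

variable [IsCofinal P]

lemma EquivModulo.of_iso (e : A ≅ B) : EquivModulo P A B :=
  let ⟨D, hD⟩ := IsCofinal.exists_biprod (P := P) A
  ⟨D, hD, P.prop_of_iso (biprod.mapIso e (Iso.refl D)) hD⟩

lemma EquivModulo.trans (h : EquivModulo P A B) (h' : EquivModulo P B D) :
    EquivModulo P A D := by
  obtain ⟨X, hAX, hBX⟩ := h
  obtain ⟨Y, hBY, hDY⟩ := h'
  refine ⟨X ⊞ (B ⊞ Y), ?_, ?_⟩
  · exact P.prop_of_iso (biprod.associator A X (B ⊞ Y)) (IsCofinal.biprod hAX hBY)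
  · exact P.prop_of_iso (biprod.associator D Y (X ⊞ B) ≪≫
      biprod.mapIso (Iso.refl D) (biprod.braiding Y (X ⊞ B) ≪≫ biprod.associator X B Y))
      (IsCofinal.biprod hDY (prop_biprod_comm hBX))

lemma EquivModulo.biprod (h : EquivModulo P A A') (h' : EquivModulo P B B') :
    EquivModulo P (A ⊞ B) (A' ⊞ B') := by
  obtain ⟨X, hAX, hAX'⟩ := h
  obtain ⟨Y, hBY, hBY'⟩ := h'
  exact ⟨X ⊞ Y, P.prop_of_iso (biprodInterchange A X B Y) (IsCofinal.biprod hAX hBY),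
    P.prop_of_iso (biprodInterchange A' X B' Y) (IsCofinal.biprod hAX' hBY')⟩

variable (P) in
/-- Equivalence modulo a cofinal property, as a setoid. -/
def equivModuloSetoid : Setoid C where
  r := EquivModulo P
  iseqv := ⟨fun A => .of_iso (Iso.refl A), .symm, .trans⟩

variable (P) in
/-- The group of objects modulo a cofinal property, with addition induced by the direct sum. -/
def CofinalQuotient : Type u₁ := Quotient (equivModuloSetoid P)

namespace CofinalQuotient

variable (P) in
/-- The class of an object in the group of objects modulo `P`. -/
def mk (A : C) : CofinalQuotient P := Quotient.mk (equivModuloSetoid P) A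

lemma mk_eq_mk : mk P A = mk P B ↔ EquivModulo P A B := Quotient.eq (r := equivModuloSetoid P)

lemma mk_eq_of_iso (e : A ≅ B) : mk P A = mk P B := mk_eq_mk.2 (.of_iso e)

instance : Add (CofinalQuotient P) where
  add := Quotient.map₂ (fun A B => A ⊞ B) fun _ _ h _ _ h' => EquivModulo.biprod h h'

lemma mk_biprod : mk P (A ⊞ B) = mk P A + mk P B := rfl

lemma mk_surjective : Function.Surjective (mk P) := Quotient.mk_surjective

variable [HasZeroObject C]

instance : Zero (CofinalQuotient P) where
  zero := mk P 0

lemma mk_eq_zero_iff : mk P A = 0 ↔ ∃ D, P D ∧ P (A ⊞ D) := by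
  have hzero (D : C) : P ((0 : C) ⊞ D) ↔ P D :=
    P.prop_iff_of_iso (isoZeroBiprod (isZero_zero C)).symm
  simp only [show (0 : CofinalQuotient P) = mk P 0 from rfl, mk_eq_mk, EquivModulo, hzero,
    and_comm]

lemma exists_add_eq_zero (a : CofinalQuotient P) : ∃ b, b + a = 0 := by
  obtain ⟨A, rfl⟩ := mk_surjective a
  obtain ⟨D, hD⟩ := IsCofinal.exists_biprod (P := P) A
  have hDA : P (D ⊞ A) := prop_biprod_comm hD
  exact ⟨mk P D, mk_eq_zero_iff.2 ⟨D ⊞ A, hDA, IsCofinal.biprod hDA hDA⟩⟩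

instance : Neg (CofinalQuotient P) where
  neg a := (exists_add_eq_zero a).choose

instance : AddGroup (CofinalQuotient P) :=
  AddGroup.ofLeftAxioms
    (fun a b c => by
      obtain ⟨A, rfl⟩ := mk_surjective a
      obtain ⟨B, rfl⟩ := mk_surjective b
      obtain ⟨D, rfl⟩ := mk_surjective c
      exact mk_eq_of_iso (biprod.associator A B D))
    (fun a => by
      obtain ⟨A, rfl⟩ := mk_surjective a
      exact mk_eq_of_iso (isoZeroBiprod (isZero_zero C)).symm)
    (fun a => (exists_add_eq_zero a).choose_spec)

instance : AddCommGroup (CofinalQuotient P) where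
  add_comm a b := by
    obtain ⟨A, rfl⟩ := mk_surjective a
    obtain ⟨B, rfl⟩ := mk_surjective b
    exact mk_eq_of_iso (biprod.braiding A B)

end CofinalQuotient

end CofinalQuotient

instance {C : Type*} [Category* C] [Preadditive C] {D : Type*} [Category* D] [Preadditive D]
    (F : C ⥤ D) [F.Additive] (A B : C) : PreservesBinaryBiproduct A B F :=
  preservesBinaryBiproduct_of_preservesBiproduct _ _ _

section Triangle

variable {C : Type u₁} [Category.{v₁} C] [Preadditive C] [HasShift C ℤ]
  [∀ n : ℤ, (shiftFunctor C n).Additive]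

instance : (Triangle.π₁ : Triangle C ⥤ C).Additive where

instance : (Triangle.π₂ : Triangle C ⥤ C).Additive where

instance : (Triangle.π₃ : Triangle C ⥤ C).Additive where

instance {D : Type u₂} [Category.{v₂} D] [Preadditive D] [HasShift D ℤ]
    [∀ n : ℤ, (shiftFunctor D n).Additive] (F : C ⥤ D) [F.CommShift ℤ] [F.Additive] :
    F.mapTriangle.Additive where

instance [HasFiniteProducts C] : HasBinaryBiproducts (Triangle C) :=
  have (S S' : Triangle C) : HasLimit (pair S S') :=
    ⟨⟨_, productTriangle.isLimitFan fun j => WalkingPair.casesOn j S S'⟩⟩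
  have := hasBinaryProducts_of_hasLimit_pair (Triangle C)
  .of_hasBinaryProducts

end Triangle

lemma biprod_distinguished {T : Type u₁} [Category.{v₁} T] [Preadditive T] [HasZeroObject T]
    [HasShift T ℤ] [∀ n : ℤ, (shiftFunctor T n).Additive] [Pretriangulated T]
    {R R' : Triangle T} (hR : R ∈ distTriang T) (hR' : R' ∈ distTriang T) :
    (R ⊞ R') ∈ distTriang T := by
  let F : WalkingPair → Triangle T := fun j => WalkingPair.casesOn j R R'
  have hF : productTriangle F ∈ distTriang T :=
    productTriangle_distinguished F (by rintro (_ | _) <;> assumption)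
  exact isomorphic_distinguished _ hF _
    ((BinaryBiproduct.isLimit R R').conePointUniqueUpToIso (productTriangle.isLimitFan F))

/-- A triangle is exact at its middle object if its first morphism is a weak kernel of the second
one; this is the part of the exactness of distinguished triangles which detects isomorphisms. -/
def ExactAtMiddle {C : Type*} [Category* C] [HasZeroMorphisms C] [HasShift C ℤ]
    (S : Triangle C) : Prop :=
  ∀ ⦃N : C⦄ (t : N ⟶ S.obj₂), t ≫ S.mor₂ = 0 → ∃ w : N ⟶ S.obj₁, t = w ≫ S.mor₁

lemma ExactAtMiddle.of_retract {C : Type*} [Category* C] [HasZeroMorphisms C] [HasShift C ℤ]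
    {S S' : Triangle C} (hS' : ExactAtMiddle S') (ρ : Retract S S') : ExactAtMiddle S := by
  intro N t ht
  obtain ⟨w, hw⟩ := hS' (t ≫ ρ.i.hom₂) (by
    rw [Category.assoc, ← ρ.i.comm₂, reassoc_of% ht, zero_comp])
  have hid : ρ.i.hom₂ ≫ ρ.r.hom₂ = 𝟙 S.obj₂ := congr_arg TriangleMorphism.hom₂ ρ.retract
  exact ⟨w ≫ ρ.r.hom₁, by
    rw [Category.assoc, ← ρ.r.comm₁, ← reassoc_of% hw, hid, Category.comp_id]⟩

lemma ExactAtMiddle.isIso_hom₂ {C : Type*} [Category* C] [Preadditive C] [HasShift C ℤ]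
    {S : Triangle C} (hS : ExactAtMiddle S) (φ : S ⟶ S) (h₁ : φ.hom₁ = 𝟙 _)
    (h₃ : φ.hom₃ = 𝟙 _) : IsIso φ.hom₂ := by
  let δ : End S.obj₂ := φ.hom₂ - 𝟙 _
  have hδ₁ : S.mor₁ ≫ δ = 0 := by
    change S.mor₁ ≫ (φ.hom₂ - 𝟙 _) = 0
    rw [Preadditive.comp_sub, φ.comm₁, h₁, Category.id_comp, Category.comp_id, sub_self]
  have hδ₂ : δ ≫ S.mor₂ = 0 := by
    change (φ.hom₂ - 𝟙 _) ≫ S.mor₂ = 0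
    rw [Preadditive.sub_comp, ← φ.comm₂, h₃, Category.id_comp, Category.comp_id, sub_self]
  obtain ⟨w, hw⟩ := hS δ hδ₂
  have hsq : δ * δ = 0 := by
    change δ ≫ δ = 0
    nth_rw 1 [hw]
    rw [Category.assoc, hδ₁, comp_zero]
  have hunit : IsUnit (1 + δ) := IsNilpotent.isUnit_one_add ⟨2, by rw [pow_two, hsq]⟩
  exact (isUnit_iff_isIso φ.hom₂).1 (by simpa [δ] using hunit)

lemma isIso_hom₂_of_exactAtMiddle {C : Type*} [Category* C] [Preadditive C] [HasShift C ℤ]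
    {S S' : Triangle C} (hS : ExactAtMiddle S) (hS' : ExactAtMiddle S') (φ : S ⟶ S') (ψ : S' ⟶ S)
    (h₁ : φ.hom₁ ≫ ψ.hom₁ = 𝟙 _) (h₁' : ψ.hom₁ ≫ φ.hom₁ = 𝟙 _)
    (h₃ : φ.hom₃ ≫ ψ.hom₃ = 𝟙 _) (h₃' : ψ.hom₃ ≫ φ.hom₃ = 𝟙 _) : IsIso φ.hom₂ := by
  have hφψ : IsIso (φ.hom₂ ≫ ψ.hom₂) := hS.isIso_hom₂ (φ ≫ ψ) h₁ h₃
  have hψφ : IsIso (ψ.hom₂ ≫ φ.hom₂) := hS'.isIso_hom₂ (ψ ≫ φ) h₁' h₃'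
  have : IsSplitMono φ.hom₂ := ⟨⟨⟨ψ.hom₂ ≫ inv (φ.hom₂ ≫ ψ.hom₂), by
    rw [← Category.assoc, IsIso.hom_inv_id]⟩⟩⟩
  have : IsSplitEpi φ.hom₂ := ⟨⟨⟨inv (ψ.hom₂ ≫ φ.hom₂) ≫ ψ.hom₂, by
    rw [Category.assoc, IsIso.inv_hom_id]⟩⟩⟩
  exact isIso_of_mono_of_isSplitEpi φ.hom₂

/-- The direct sum of two retracts. -/
def retractBiprod {C : Type*} [Category* C] [HasZeroMorphisms C] [HasBinaryBiproducts C]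
    {A A' B B' : C} (ρ : Retract A A') (σ : Retract B B') : Retract (A ⊞ B) (A' ⊞ B') where
  i := biprod.map ρ.i σ.i
  r := biprod.map ρ.r σ.r

section Karoubi

variable {T : Type u₁} [Category.{v₁} T] [Preadditive T] [HasShift T ℤ]
  [∀ n : ℤ, (shiftFunctor T n).Additive]

instance (n : ℤ) : (shiftFunctor (Karoubi T) n).Additive where
  map_add := by
    intro X Y f g
    ext
    exact (shiftFunctor T n).map_add

variable [HasZeroObject T] [Pretriangulated T]

instance : HasFiniteBiproducts T := HasFiniteBiproducts.of_hasFiniteProducts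

instance : HasBinaryBiproducts (Karoubi T) := hasBinaryBiproducts_of_finite_biproducts _

lemma mapTriangle_toKaroubi_mem {R : Triangle T} (hR : R ∈ distTriang T) :
    (toKaroubi T).mapTriangle.obj R ∈ karoubiDistTriang T :=
  ⟨R, hR, ⟨Retract.refl _⟩⟩

variable {S S' : Triangle (Karoubi T)}

lemma karoubiDistTriang_of_retract (hS : S ∈ karoubiDistTriang T) (ρ : Retract S' S) :
    S' ∈ karoubiDistTriang T :=
  let ⟨R, hR, ⟨σ⟩⟩ := hS
  ⟨R, hR, ⟨ρ.trans σ⟩⟩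

lemma biprod_mem_karoubiDistTriang (hS : S ∈ karoubiDistTriang T)
    (hS' : S' ∈ karoubiDistTriang T) : (S ⊞ S') ∈ karoubiDistTriang T := by
  obtain ⟨R, hR, ⟨ρ⟩⟩ := hS
  obtain ⟨R', hR', ⟨ρ'⟩⟩ := hS'
  exact ⟨R ⊞ R', biprod_distinguished hR hR', ⟨(retractBiprod ρ ρ').trans
    (.ofIso ((toKaroubi T).mapTriangle.mapBiprod R R').symm)⟩⟩

lemma rotate_mem_karoubiDistTriang (hS : S ∈ karoubiDistTriang T) :
    S.rotate ∈ karoubiDistTriang T :=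
  let ⟨R, hR, ⟨ρ⟩⟩ := hS
  ⟨R.rotate, rot_of_distTriang R hR, ⟨(ρ.map (rotate _)).trans
    (.ofIso ((toKaroubi T).mapTriangleRotateIso.app R))⟩⟩

lemma invRotate_mem_karoubiDistTriang (hS : S ∈ karoubiDistTriang T) :
    S.invRotate ∈ karoubiDistTriang T :=
  let ⟨R, hR, ⟨ρ⟩⟩ := hS
  ⟨R.invRotate, inv_rot_of_distTriang R hR, ⟨(ρ.map (invRotate _)).trans
    (.ofIso ((toKaroubi T).mapTriangleInvRotateIso.app R))⟩⟩

variable (T) in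
/-- Applying the embedding in the idempotent completion to a contractible triangle. -/
def mapContractibleTriangleIso (X : T) :
    (toKaroubi T).mapTriangle.obj (contractibleTriangle X) ≅
      contractibleTriangle ((toKaroubi T).obj X) :=
  Triangle.isoMk _ _ (Iso.refl _) (Iso.refl _)
    (((toKaroubi T).map_isZero (isZero_zero T)).iso (isZero_zero _))
    (congr_arg (· ≫ 𝟙 _) ((toKaroubi T).map_id X)) ((isZero_zero _).eq_of_tgt _ _)
    (((toKaroubi T).map_isZero (isZero_zero T)).eq_of_src _ _)

lemma contractibleTriangle_mem_karoubiDistTriang (A : Karoubi T) :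
    contractibleTriangle A ∈ karoubiDistTriang T :=
  have ρ : Retract A ((toKaroubi T).obj A.X) := ⟨A.decompId_i, A.decompId_p, A.decompId.symm⟩
  ⟨_, contractible_distinguished A.X, ⟨(ρ.map (contractibleTriangleFunctor _)).trans
    (.ofIso (mapContractibleTriangleIso T A.X).symm)⟩⟩

lemma exactAtMiddle_mapTriangle_toKaroubi {R : Triangle T} (hR : R ∈ distTriang T) :
    ExactAtMiddle ((toKaroubi T).mapTriangle.obj R) := by
  intro N (t : N ⟶ (toKaroubi T).obj R.obj₂) (ht : t ≫ (toKaroubi T).map R.mor₂ = 0)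
  obtain ⟨t', ht'⟩ := (toKaroubi T).map_surjective (N.decompId_p ≫ t)
  have htR : t' ≫ R.mor₂ = 0 := (toKaroubi T).map_injective (by
    rw [Functor.map_comp, ht', Category.assoc, ht, comp_zero, Functor.map_zero])
  obtain ⟨w, rfl⟩ := Triangle.coyoneda_exact₂ R hR t' htR
  exact ⟨N.decompId_i ≫ (toKaroubi T).map w, calc
    t = N.decompId_i ≫ N.decompId_p ≫ t := N.decompId_assoc t
    _ = N.decompId_i ≫ (toKaroubi T).map (w ≫ R.mor₁) := by rw [ht']
    _ = (N.decompId_i ≫ (toKaroubi T).map w) ≫ (toKaroubi T).map R.mor₁ := by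
      rw [Functor.map_comp, Category.assoc]⟩

lemma exactAtMiddle_of_mem_karoubiDistTriang (hS : S ∈ karoubiDistTriang T) :
    ExactAtMiddle S :=
  let ⟨_, hR, ⟨ρ⟩⟩ := hS
  (exactAtMiddle_mapTriangle_toKaroubi hR).of_retract ρ

end Karoubi

section Extension

variable {T : Type u₁} [Category.{v₁} T] [Preadditive T] [HasZeroObject T] [HasShift T ℤ]
  [∀ n : ℤ, (shiftFunctor T n).Additive] [Pretriangulated T]

lemma exists_hom_mapTriangle_toKaroubi {U R : Triangle T} (hU : U ∈ distTriang T)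
    (hR : R ∈ distTriang T)
    (a : ((toKaroubi T).mapTriangle.obj U).obj₁ ⟶ ((toKaroubi T).mapTriangle.obj R).obj₁)
    (c : ((toKaroubi T).mapTriangle.obj U).obj₃ ⟶ ((toKaroubi T).mapTriangle.obj R).obj₃)
    (h : ((toKaroubi T).mapTriangle.obj U).mor₃ ≫ a⟦(1 : ℤ)⟧' =
      c ≫ ((toKaroubi T).mapTriangle.obj R).mor₃) :
    ∃ φ : (toKaroubi T).mapTriangle.obj U ⟶ (toKaroubi T).mapTriangle.obj R,
      φ.hom₁ = a ∧ φ.hom₃ = c := by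
  obtain ⟨a, rfl⟩ := (toKaroubi T).map_surjective a
  obtain ⟨c, rfl⟩ := (toKaroubi T).map_surjective c
  have hnat : (toKaroubi T).map (a⟦(1 : ℤ)⟧') ≫
      ((toKaroubi T).commShiftIso (1 : ℤ)).hom.app R.obj₁ =
        ((toKaroubi T).commShiftIso (1 : ℤ)).hom.app U.obj₁ ≫ ((toKaroubi T).map a)⟦(1 : ℤ)⟧' :=
    ((toKaroubi T).commShiftIso (1 : ℤ)).hom.naturality a
  have h' : U.mor₃ ≫ a⟦(1 : ℤ)⟧' = c ≫ R.mor₃ := (toKaroubi T).map_injective <| by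
    rw [← cancel_mono (((toKaroubi T).commShiftIso (1 : ℤ)).hom.app R.obj₁),
      Functor.map_comp, Functor.map_comp, Category.assoc, Category.assoc, hnat]
    exact (Category.assoc _ _ _).symm.trans h
  obtain ⟨b, hb₁, hb₂⟩ := complete_distinguished_triangle_morphism₂ U R hU hR a c h'
  exact ⟨(toKaroubi T).mapTriangle.map (Triangle.homMk U R a b c hb₁ hb₂ h'), rfl, rfl⟩

lemma exists_hom_of_mem_karoubiDistTriang {S S' : Triangle (Karoubi T)}
    (hS : S ∈ karoubiDistTriang T) (hS' : S' ∈ karoubiDistTriang T) (a : S.obj₁ ⟶ S'.obj₁)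
    (c : S.obj₃ ⟶ S'.obj₃) (h : S.mor₃ ≫ a⟦(1 : ℤ)⟧' = c ≫ S'.mor₃) :
    ∃ φ : S ⟶ S', φ.hom₁ = a ∧ φ.hom₃ = c := by
  obtain ⟨R, hR, ⟨ρ⟩⟩ := hS
  obtain ⟨R', hR', ⟨ρ'⟩⟩ := hS'
  obtain ⟨ψ, hψ₁, hψ₃⟩ := exists_hom_mapTriangle_toKaroubi hR hR'
    (ρ.r.hom₁ ≫ a ≫ ρ'.i.hom₁) (ρ.r.hom₃ ≫ c ≫ ρ'.i.hom₃) (by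
      rw [Functor.map_comp, Functor.map_comp, ← Category.assoc, ρ.r.comm₃, Category.assoc,
        reassoc_of% h, ρ'.i.comm₃, Category.assoc, Category.assoc])
  have hρ₁ : ρ.i.hom₁ ≫ ρ.r.hom₁ = 𝟙 _ := congr_arg TriangleMorphism.hom₁ ρ.retract
  have hρ₃ : ρ.i.hom₃ ≫ ρ.r.hom₃ = 𝟙 _ := congr_arg TriangleMorphism.hom₃ ρ.retract
  have hρ₁' : ρ'.i.hom₁ ≫ ρ'.r.hom₁ = 𝟙 _ := congr_arg TriangleMorphism.hom₁ ρ'.retract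
  have hρ₃' : ρ'.i.hom₃ ≫ ρ'.r.hom₃ = 𝟙 _ := congr_arg TriangleMorphism.hom₃ ρ'.retract
  refine ⟨ρ.i ≫ ψ ≫ ρ'.r, ?_, ?_⟩
  · rw [comp_hom₁, comp_hom₁, hψ₁, Category.assoc, Category.assoc, hρ₁', Category.comp_id,
      reassoc_of% hρ₁]
  · rw [comp_hom₃, comp_hom₃, hψ₃, Category.assoc, Category.assoc, hρ₃', Category.comp_id,
      reassoc_of% hρ₃]

lemma nonempty_iso_obj₂_of_mem_karoubiDistTriang {S S' : Triangle (Karoubi T)}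
    (hS : S ∈ karoubiDistTriang T) (hS' : S' ∈ karoubiDistTriang T) (e₁ : S.obj₁ ≅ S'.obj₁)
    (e₃ : S.obj₃ ≅ S'.obj₃) (h : S.mor₃ ≫ e₁.hom⟦(1 : ℤ)⟧' = e₃.hom ≫ S'.mor₃) :
    Nonempty (S.obj₂ ≅ S'.obj₂) := by
  have h' : S'.mor₃ ≫ e₁.inv⟦(1 : ℤ)⟧' = e₃.inv ≫ S.mor₃ := by
    rw [Iso.eq_inv_comp, ← reassoc_of% h, ← Functor.map_comp, e₁.hom_inv_id,
      (shiftFunctor _ (1 : ℤ)).map_id, Category.comp_id]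
  obtain ⟨φ, hφ₁, hφ₃⟩ := exists_hom_of_mem_karoubiDistTriang hS hS' e₁.hom e₃.hom h
  obtain ⟨ψ, hψ₁, hψ₃⟩ := exists_hom_of_mem_karoubiDistTriang hS' hS e₁.inv e₃.inv h'
  have := isIso_hom₂_of_exactAtMiddle (exactAtMiddle_of_mem_karoubiDistTriang hS)
    (exactAtMiddle_of_mem_karoubiDistTriang hS') φ ψ (by rw [hφ₁, hψ₁, e₁.hom_inv_id])
    (by rw [hφ₁, hψ₁, e₁.inv_hom_id]) (by rw [hφ₃, hψ₃, e₃.hom_inv_id])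
    (by rw [hφ₃, hψ₃, e₃.inv_hom_id])
  exact ⟨asIso φ.hom₂⟩

-- The embedding is full, so that the third morphism of `S` comes from a morphism of `T`, and
-- the latter completes to a distinguished triangle of `T`.
lemma essImage_toKaroubi_obj₂ {S : Triangle (Karoubi T)} (hS : S ∈ karoubiDistTriang T)
    (h₁ : (toKaroubi T).essImage S.obj₁) (h₃ : (toKaroubi T).essImage S.obj₃) :
    (toKaroubi T).essImage S.obj₂ := by
  obtain ⟨X, ⟨e₁⟩⟩ := h₁
  obtain ⟨Z, ⟨e₃⟩⟩ := h₃
  obtain ⟨k, hk⟩ := (toKaroubi T).map_surjective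
    (e₃.hom ≫ S.mor₃ ≫ e₁.inv⟦(1 : ℤ)⟧' ≫ ((toKaroubi T).commShiftIso (1 : ℤ)).inv.app X)
  obtain ⟨Y, f, g, hU⟩ := distinguished_cocone_triangle₂ k
  have hmor₃ : ((toKaroubi T).map k ≫ ((toKaroubi T).commShiftIso (1 : ℤ)).hom.app X) ≫
      e₁.hom⟦(1 : ℤ)⟧' = e₃.hom ≫ S.mor₃ := by
    rw [hk, Category.assoc, Category.assoc, Category.assoc, Category.assoc,
      Iso.inv_hom_id_app_assoc, ← Functor.map_comp, e₁.inv_hom_id, (shiftFunctor _ (1 : ℤ)).map_id,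
      Category.comp_id]
  exact ⟨Y, nonempty_iso_obj₂_of_mem_karoubiDistTriang (mapTriangle_toKaroubi_mem hU) hS
    e₁ e₃ hmor₃⟩

instance : IsCofinal (toKaroubi T).essImage where
  biprod := fun ⟨X, ⟨e⟩⟩ ⟨Y, ⟨e'⟩⟩ =>
    ⟨X ⊞ Y, ⟨(toKaroubi T).mapBiprod X Y ≪≫ biprod.mapIso e e'⟩⟩
  exists_biprod A := ⟨A.complement, A.X, ⟨A.decomposition.symm⟩⟩

-- The sum of the triangles `A ⟶ A ⟶ 0` and `D ⟶ 0 ⟶ D⟦1⟧` has the middle object `A`.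
lemma essImage_toKaroubi_of_biprod {A D : Karoubi T} (hAD : (toKaroubi T).essImage (A ⊞ D))
    (hD : (toKaroubi T).essImage D) : (toKaroubi T).essImage A := by
  let S := contractibleTriangle A ⊞ (contractibleTriangle D).rotate
  have hS : S ∈ karoubiDistTriang T := biprod_mem_karoubiDistTriang
    (contractibleTriangle_mem_karoubiDistTriang A)
    (rotate_mem_karoubiDistTriang (contractibleTriangle_mem_karoubiDistTriang D))
  have e₁ : S.obj₁ ≅ A ⊞ D := Triangle.π₁.mapBiprod _ _
  have e₂ : S.obj₂ ≅ A := Triangle.π₂.mapBiprod _ _ ≪≫ (isoBiprodZero (isZero_zero _)).symm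
  have e₃ : S.obj₃ ≅ D⟦(1 : ℤ)⟧ :=
    Triangle.π₃.mapBiprod _ _ ≪≫ (isoZeroBiprod (isZero_zero _)).symm
  have hDshift : (toKaroubi T).essImage (D⟦(1 : ℤ)⟧) := by
    obtain ⟨X, ⟨e⟩⟩ := hD
    exact ⟨X⟦(1 : ℤ)⟧, ⟨((toKaroubi T).commShiftIso (1 : ℤ)).app X ≪≫
      (shiftFunctor (Karoubi T) (1 : ℤ)).mapIso e⟩⟩
  exact ObjectProperty.prop_of_iso _ e₂ <| essImage_toKaroubi_obj₂ hS
    (ObjectProperty.prop_of_iso _ e₁.symm hAD) (ObjectProperty.prop_of_iso _ e₃.symm hDshift)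

-- Adding the triangles `A ⟶ A ⟶ 0` and `0 ⟶ D ⟶ D` to `S`, for complements `A` of `S.obj₁` and
-- `D` of `S.obj₃`, moves the outer objects into the image of the embedding.
lemma mk_essImage_toKaroubi_obj₂ {S : Triangle (Karoubi T)} (hS : S ∈ karoubiDistTriang T) :
    CofinalQuotient.mk (toKaroubi T).essImage S.obj₂ =
      CofinalQuotient.mk _ S.obj₁ + CofinalQuotient.mk _ S.obj₃ := by
  obtain ⟨A, hA⟩ := IsCofinal.exists_biprod (P := (toKaroubi T).essImage) S.obj₁
  obtain ⟨D, hD⟩ := IsCofinal.exists_biprod (P := (toKaroubi T).essImage) S.obj₃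
  let C := contractibleTriangle A ⊞ (contractibleTriangle D).invRotate
  have hC : C ∈ karoubiDistTriang T := biprod_mem_karoubiDistTriang
    (contractibleTriangle_mem_karoubiDistTriang A)
    (invRotate_mem_karoubiDistTriang (contractibleTriangle_mem_karoubiDistTriang D))
  have hzero : IsZero (contractibleTriangle D).invRotate.obj₁ :=
    (shiftFunctor (Karoubi T) (-1 : ℤ)).map_isZero (isZero_zero _)
  have e₁ : (S ⊞ C).obj₁ ≅ S.obj₁ ⊞ A := Triangle.π₁.mapBiprod _ _ ≪≫
    biprod.mapIso (Iso.refl _) (Triangle.π₁.mapBiprod _ _ ≪≫ (isoBiprodZero hzero).symm)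
  have e₂ : (S ⊞ C).obj₂ ≅ S.obj₂ ⊞ (A ⊞ D) := Triangle.π₂.mapBiprod _ _ ≪≫
    biprod.mapIso (Iso.refl _) (Triangle.π₂.mapBiprod _ _)
  have e₃ : (S ⊞ C).obj₃ ≅ S.obj₃ ⊞ D := Triangle.π₃.mapBiprod _ _ ≪≫ biprod.mapIso (Iso.refl _)
    (Triangle.π₃.mapBiprod _ _ ≪≫ (isoZeroBiprod (isZero_zero _)).symm)
  have hmid : (toKaroubi T).essImage (S.obj₂ ⊞ (A ⊞ D)) :=
    ObjectProperty.prop_of_iso _ e₂ <| essImage_toKaroubi_obj₂ (biprod_mem_karoubiDistTriang hS hC)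
      (ObjectProperty.prop_of_iso _ e₁.symm hA) (ObjectProperty.prop_of_iso _ e₃.symm hD)
  rw [← CofinalQuotient.mk_biprod, CofinalQuotient.mk_eq_mk]
  exact ⟨A ⊞ D, hmid, ObjectProperty.prop_of_iso _ (biprodInterchange S.obj₁ A S.obj₃ D)
    (IsCofinal.biprod hA hD)⟩

lemma essImage_toKaroubi_of_mk_eq_zero {A : Karoubi T}
    (hA : CofinalQuotient.mk (toKaroubi T).essImage A = 0) : (toKaroubi T).essImage A :=
  let ⟨_, hD, hAD⟩ := CofinalQuotient.mk_eq_zero_iff.1 hA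
  essImage_toKaroubi_of_biprod hAD hD

theorem isIdempotentComplete_of_subsingleton_k0Completion [Subsingleton (K0Completion T)] :
    IsIdempotentComplete T := by
  have : (toKaroubi T).EssSurj := ⟨fun A => essImage_toKaroubi_of_mk_eq_zero <| by
    rw [← k0Lift_k0Class (CofinalQuotient.mk _) fun _ => mk_essImage_toKaroubi_obj₂,
      Subsingleton.elim (α := K0Completion T) (k0Class _ A) 0, map_zero]⟩
  have : (toKaroubi T).IsEquivalence := {}
  exact (isIdempotentComplete_iff_of_equivalence (toKaroubi T).asEquivalence).2 inferInstance

theorem subsingleton_k0Completion_of_isIdempotentComplete [IsIdempotentComplete T]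
    [Subsingleton (K0 T (distTriang T))] : Subsingleton (K0Completion T) :=
  subsingleton_k0_of_essSurj
    (k0Class_of_iso contractibleTriangle_mem_karoubiDistTriang
      fun _ hS _ e => karoubiDistTriang_of_retract hS (.ofIso e))
    (toKaroubi T) fun _ => mapTriangle_toKaroubi_mem

theorem isIdempotentComplete_iff_subsingleton_k0Completion [Subsingleton (K0 T (distTriang T))] :
    IsIdempotentComplete T ↔ Subsingleton (K0Completion T) :=
  ⟨fun _ => subsingleton_k0Completion_of_isIdempotentComplete,
    fun _ => isIdempotentComplete_of_subsingleton_k0Completion⟩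

end Extension

section Swindle

lemma hasCoproduct_of_finite_not_isZero {C : Type*} [Category* C] [HasZeroMorphisms C]
    [HasFiniteCoproducts C] {J : Type*} (f : J → C) (hf : {j | ¬IsZero (f j)}.Finite) :
    HasCoproduct f := by
  have : Finite {j // ¬IsZero (f j)} := hf
  let g : {j // ¬IsZero (f j)} → C := fun j => f j
  classical
  let c : Cofan f := Cofan.mk (∐ g) fun j => if h : ¬IsZero (f j) then Sigma.ι g ⟨j, h⟩ else 0
  have hc (j : {j // ¬IsZero (f j)}) : c.inj j = Sigma.ι g j := dif_pos j.2
  refine ⟨⟨c, Cofan.IsColimit.mk c (fun s => Limits.Sigma.desc (f := g) fun j => s.inj j)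
    (fun s j => ?_) fun s m hm => Limits.Sigma.hom_ext (f := g) _ _ fun j => ?_⟩⟩
  · by_cases hj : IsZero (f j)
    · exact hj.eq_of_src _ _
    · rw [hc ⟨j, hj⟩, Sigma.ι_desc]
  · rw [Sigma.ι_desc, ← hm j, hc]

section

variable {C : Type*} [Category* C] [HasZeroMorphisms C] [HasBinaryBiproducts C] {F : ℕ → C}

/-- The cofan over `F` obtained from a cofan over `k ↦ F (k + 1)` by adding the summand `F 0`. -/
def consCofan (c : Cofan fun k => F (k + 1)) : Cofan F :=
  Cofan.mk (F 0 ⊞ c.pt) fun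
    | 0 => biprod.inl
    | k + 1 => c.inj k ≫ biprod.inr

/-- Adding a summand to a coproduct gives a coproduct. -/
def isColimitConsCofan {c : Cofan fun k => F (k + 1)} (hc : IsColimit c) :
    IsColimit (consCofan c) :=
  Cofan.IsColimit.mk _
    (fun s => biprod.desc (s.inj 0) (Cofan.IsColimit.desc hc fun k => s.inj (k + 1)))
    (fun s => by
      rintro (_ | k)
      · exact biprod.inl_desc _ _
      · change (c.inj k ≫ biprod.inr) ≫ _ = _
        rw [Category.assoc, biprod.inr_desc, Cofan.IsColimit.fac])
    (fun s m hm => by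
      refine biprod.hom_ext' _ _ ((hm 0).trans (biprod.inl_desc _ _).symm) ?_
      rw [biprod.inr_desc]
      exact Cofan.IsColimit.hom_ext hc _ _ fun k => by
        rw [Cofan.IsColimit.fac, ← hm (k + 1)]
        exact (Category.assoc _ _ _).symm)

lemma nonempty_sigma_iso_biprod_obj_sigma [HasCoproduct F] (G : C ⥤ C)
    [PreservesColimit (Discrete.functor F) G] (α : ∀ k, F (k + 1) ≅ G.obj (F k)) :
    Nonempty (∐ F ≅ F 0 ⊞ G.obj (∐ F)) :=
  have hG := isColimitCofanMkObjOfIsColimit G F (Sigma.ι F) (coproductIsCoproduct F)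
  have hα := (IsColimit.precomposeHomEquiv (Discrete.natIso fun k => α k.as) _).symm hG
  ⟨(coproductIsCoproduct F).coconePointUniqueUpToIso (isColimitConsCofan hα)⟩

end

variable {E : Type u₂} [Category.{v₂} E] [Preadditive E] [HasZeroObject E]
  [HasBinaryBiproducts E]

instance : HasBinaryBiproducts (CochainComplex E ℤ) := ⟨fun _ _ => inferInstance⟩

-- The complex `B` is the direct sum of the shifts of `A` by the multiples of `e`.
lemma exists_iso_biprod_shift (A : CochainComplex E ℤ) (e : ℤ)
    (hA : ∀ n : ℤ, {k : ℕ | ¬IsZero (A.X (n + k * e))}.Finite) :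
    ∃ B : CochainComplex E ℤ, Nonempty (B ≅ A ⊞ B⟦e⟧) := by
  have : HasFiniteCoproducts E := hasFiniteCoproducts_of_has_binary_and_initial
  let F : ℕ → CochainComplex E ℤ := fun k => A⟦(k * e : ℤ)⟧
  have (n : ℤ) : HasColimit (Discrete.functor F ⋙ HomologicalComplex.eval E (.up ℤ) n) :=
    have : HasCoproduct fun k => (F k).X n := hasCoproduct_of_finite_not_isZero _ (hA n)
    hasColimit_of_iso (F := Discrete.functor fun k => (F k).X n)
      (Discrete.natIso fun _ => Iso.refl _)
  have : HasCoproduct F := inferInstanceAs (HasColimit (Discrete.functor F))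
  have α (k : ℕ) : F (k + 1) ≅ (F k)⟦e⟧ :=
    (shiftFunctorAdd' _ (k * e : ℤ) e ((k + 1 : ℕ) * e : ℤ) (by push_cast; ring)).app A
  have α₀ : F 0 ≅ A :=
    (shiftFunctorZero' _ ((0 : ℕ) * e : ℤ) (by rw [Nat.cast_zero, zero_mul])).app A
  obtain ⟨i⟩ := nonempty_sigma_iso_biprod_obj_sigma (shiftFunctor _ e) α
  exact ⟨∐ F, ⟨i ≪≫ biprod.mapIso α₀ (Iso.refl _)⟩⟩

lemma k0Class_quotient_eq_zero (A : CochainComplex E ℤ) {e : ℤ} (he : Even e)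
    (hA : ∀ n : ℤ, {k : ℕ | ¬IsZero (A.X (n + k * e))}.Finite) :
    k0Class (distTriang (KCat E)) ((HomotopyCategory.quotient E (.up ℤ)).obj A) = 0 := by
  let q := HomotopyCategory.quotient E (ComplexShape.up ℤ)
  obtain ⟨B, ⟨i⟩⟩ := exists_iso_biprod_shift A e hA
  have hB : k0Class (distTriang (KCat E)) (q.obj B) =
      k0Class _ (q.obj A) + k0Class _ (q.obj B) := calc
    k0Class (distTriang (KCat E)) (q.obj B) = k0Class _ (q.obj A ⊞ (q.obj B)⟦e⟧) :=
      k0Class_eq_of_iso (q.mapIso i ≪≫ q.mapBiprod A (B⟦e⟧) ≪≫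
        biprod.mapIso (Iso.refl _) ((q.commShiftIso e).app B))
    _ = k0Class _ (q.obj A) + k0Class _ (q.obj B) := by
      rw [k0Class_biprod, k0Class_shift, Int.negOnePow_even e he, one_smul]
  exact right_eq_add.1 hB

end Swindle

section StupidTrunc

open HomologicalComplex ComplexShape

variable {ι ι₁ ι₂ : Type*} {c : ComplexShape ι} {c₁ : ComplexShape ι₁} {c₂ : ComplexShape ι₂}

section

variable {C : Type*} [Category* C] [HasZeroMorphisms C] [HasZeroObject C]
  (K : HomologicalComplex C c) (e₁ : c₁.Embedding c) (e₂ : c₂.Embedding c)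

/-- The projection of a complex to its brutal truncation in small degrees. -/
def stupidTruncπ [e₁.IsTruncLE] : K ⟶ K.stupidTrunc e₁ :=
  e₁.liftExtend (𝟙 (K.restriction e₁)) fun _ hj i' hi' =>
    let ⟨i, hi⟩ := e₁.mem_prev hi'
    (hj.2 i (by rwa [hi])).elim

lemma isIso_stupidTruncπ_f [e₁.IsTruncLE] (i : ι₁) : IsIso ((stupidTruncπ K e₁).f (e₁.f i)) :=
  (e₁.isIso_liftExtend_f_iff _ _ rfl).2 (inferInstanceAs (IsIso (𝟙 _)))

lemma stupidTruncXIso_hom_comp_d (e : c₁.Embedding c) [e.IsRelIff] {i j : ι₁} {n m : ι}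
    (hi : e.f i = n) (hj : e.f j = m) :
    (K.stupidTruncXIso e hi).hom ≫ K.d n m =
      (K.stupidTrunc e).d n m ≫ (K.stupidTruncXIso e hj).hom := by
  change ((K.restriction e).extendXIso e hi ≪≫ K.restrictionXIso e hi).hom ≫ K.d n m =
    ((K.restriction e).extend e).d n m ≫
      ((K.restriction e).extendXIso e hj ≪≫ K.restrictionXIso e hj).hom
  simp only [(K.restriction e).extend_d_eq e hi hj, K.restriction_d_eq e hi hj, Iso.trans_hom,
    Category.assoc, Iso.inv_hom_id_assoc, Iso.inv_hom_id, Category.comp_id]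

open scoped Classical in
/-- The inclusion of the brutal truncation of a complex in large degrees. -/
def stupidTruncι [e₂.IsTruncGE] : K.stupidTrunc e₂ ⟶ K where
  f n := if h : ∃ i, e₂.f i = n then (K.stupidTruncXIso e₂ h.choose_spec).hom else 0
  comm' n m hnm := by
    by_cases hn : ∃ i, e₂.f i = n
    · obtain ⟨i, rfl⟩ := hn
      rw [dif_pos ⟨i, rfl⟩, dif_pos (e₂.mem_next hnm), stupidTruncXIso_hom_comp_d]
    · exact (K.isZero_stupidTrunc_X e₂ n (not_exists.1 hn)).eq_of_src _ _

lemma isIso_stupidTruncι_f [e₂.IsTruncGE] (i : ι₂) : IsIso ((stupidTruncι K e₂).f (e₂.f i)) := by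
  have hi : ∃ k, e₂.f k = e₂.f i := ⟨i, rfl⟩
  simp only [stupidTruncι, dif_pos hi]
  infer_instance

variable {e₁ e₂}

/-- The two brutal truncations of a complex at the same place. -/
def stupidTruncShortComplex [e₁.IsTruncLE] [e₂.IsTruncGE] (h : e₁.AreComplementary e₂) :
    ShortComplex (HomologicalComplex C c) :=
  ShortComplex.mk (stupidTruncι K e₂) (stupidTruncπ K e₁) <| by
    ext n
    obtain ⟨i, rfl⟩ | ⟨i, rfl⟩ := h.union n
    · exact (K.isZero_stupidTrunc_X e₂ _ fun j => (h.disjoint i j).symm).eq_of_src _ _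
    · exact (K.isZero_stupidTrunc_X e₁ _ fun j => h.disjoint j i).eq_of_tgt _ _

end

lemma nonempty_splitting_stupidTruncShortComplex {C : Type*} [Category* C] [Preadditive C]
    [HasZeroObject C] (K : HomologicalComplex C c) {e₁ : c₁.Embedding c} {e₂ : c₂.Embedding c}
    [e₁.IsTruncLE] [e₂.IsTruncGE] (h : e₁.AreComplementary e₂) (n : ι) :
    Nonempty ((stupidTruncShortComplex K h).map (eval C c n)).Splitting := by
  obtain ⟨i, rfl⟩ | ⟨i, rfl⟩ := h.union n
  · exact ⟨.ofIsZeroOfIsIso _ (K.isZero_stupidTrunc_X e₂ _ fun j => (h.disjoint i j).symm)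
      (isIso_stupidTruncπ_f K e₁ i)⟩
  · exact ⟨.ofIsIsoOfIsZero _ (isIso_stupidTruncι_f K e₂ i)
      (K.isZero_stupidTrunc_X e₁ _ fun j => h.disjoint j i)⟩

end StupidTrunc

section HomotopyCategory

variable {E : Type u₂} [Category.{v₂} E] [Preadditive E] [HasZeroObject E]
  [HasBinaryBiproducts E]

open ComplexShape

lemma k0Class_quotient_eq_zero_of_isStrictlyGE (A : CochainComplex E ℤ) (a : ℤ)
    [A.IsStrictlyGE a] :
    k0Class (distTriang (KCat E)) ((HomotopyCategory.quotient E (.up ℤ)).obj A) = 0 :=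
  k0Class_quotient_eq_zero A (e := -2) (by decide) fun n =>
    (Set.finite_Iic (n - a).natAbs).subset fun k hk => by
      have := not_lt.1 fun h => hk (A.isZero_of_isStrictlyGE a _ h)
      rw [Set.mem_Iic]
      omega

lemma k0Class_quotient_eq_zero_of_isStrictlyLE (A : CochainComplex E ℤ) (b : ℤ)
    [A.IsStrictlyLE b] :
    k0Class (distTriang (KCat E)) ((HomotopyCategory.quotient E (.up ℤ)).obj A) = 0 :=
  k0Class_quotient_eq_zero A even_two fun n =>
    (Set.finite_Iic (n - b).natAbs).subset fun k hk => by
      have := not_lt.1 fun h => hk (A.isZero_of_isStrictlyLE b _ h)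
      rw [Set.mem_Iic]
      omega

variable (E) in
theorem subsingleton_k0_homotopyCategory : Subsingleton (K0 (KCat E) (distTriang (KCat E))) := by
  refine subsingleton_k0_of_k0Class_eq_zero fun K => ?_
  obtain ⟨A, rfl⟩ := HomotopyCategory.quotient_obj_surjective K
  have h := Embedding.embeddingUpInt_areComplementary (-1) 0 rfl
  have hadd := k0Class_obj₂ ((HomotopyCategory.distinguished_iff_iso_trianglehOfDegreewiseSplit _).2
    ⟨stupidTruncShortComplex A h,
      fun n => (nonempty_splitting_stupidTruncShortComplex A h n).some, ⟨Iso.refl _⟩⟩)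
  have hGE := k0Class_quotient_eq_zero_of_isStrictlyGE (A.stupidTrunc (embeddingUpIntGE 0)) 0
  have hLE := k0Class_quotient_eq_zero_of_isStrictlyLE (A.stupidTrunc (embeddingUpIntLE (-1))) (-1)
  exact hadd.trans ((congrArg₂ _ hGE hLE).trans (add_zero 0))

end HomotopyCategory

end HigherDerived

end

open HigherDerived in
universe v₃ u₃ in
theorem mainTheorem3_general :
    (∀ (T : Type u₁) [Category.{v₁} T] [Preadditive T] [HasZeroObject T] [HasShift T ℤ]
      [∀ n : ℤ, (shiftFunctor T n).Additive] [Pretriangulated T],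
      Subsingleton (K0Completion T) → IsIdempotentComplete T) ∧
    (∀ (E : Type u₂) [Category.{v₂} E] [Preadditive E] [HasZeroObject E] [HasBinaryBiproducts E]
      (D : Type u₃) [Category.{v₃} D] [Preadditive D] [HasZeroObject D] [HasShift D ℤ]
      [∀ n : ℤ, (shiftFunctor D n).Additive] [Pretriangulated D]
      (F : KCat E ⥤ D) [F.CommShift ℤ] [F.IsTriangulated] [F.EssSurj],
      IsIdempotentComplete D ↔ Subsingleton (K0Completion D)) := by
  refine ⟨fun T => ?_, fun E _ _ _ _ D _ _ _ _ _ _ F _ _ _ => ?_⟩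
  · intros
    exact isIdempotentComplete_of_subsingleton_k0Completion
  · have := subsingleton_k0_homotopyCategory E
    have := subsingleton_k0_of_essSurj (dist := distTriang _) (dist' := distTriang _)
      k0Class_eq_of_iso F F.map_distinguished
    exact isIdempotentComplete_iff_subsingleton_k0Completion

theorem mainTheorem3 :
    (∀ (T : Type u₁) [Category.{v₁} T] [EssentiallySmall.{w₁} T] [Preadditive T]
      [HasZeroObject T] [HasShift T ℤ] [∀ n : ℤ, (shiftFunctor T n).Additive]
      [Pretriangulated T] [IsTriangulated T],
      Subsingleton (HigherDerived.K0Completion T) → IsIdempotentComplete T) ∧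
    (∀ (E : Type u₂) [Category.{v₂} E] [EssentiallySmall.{w₂} E] [Preadditive E]
      [HasZeroObject E] [HasBinaryBiproducts E] [IsIdempotentComplete E]
      (X : HigherDerived.ExactStructure E) (w : MorphismProperty E),
      HigherDerived.IsWeakEquivalenceClass X w →
        (IsIdempotentComplete (HigherDerived.DCat X w) ↔
          Subsingleton (HigherDerived.K0Completion (HigherDerived.DCat X w)))) := by
  obtain ⟨h, h'⟩ := mainTheorem3_general.{v₁, v₂, u₁, u₂, max u₂ v₂, max u₂ v₂}
  exact ⟨fun T => h T, fun E _ _ _ _ _ _ X w _ => h' E _ (HigherDerived.verdierQ _)⟩
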